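/- Let $N,n\ge 1$, and let $J^\infty E$ be the infinite jet space of the trivial line bundle $E=\mathbf R^N\times\mathbf R\to\mathbf R^N$, with coordinates $(x^i,u_J)$, where $1\le i\le N$ and $J$ runs over the multi-indices $(j_1,\dots,j_N)$, $j_i\ge 0$, of order $|J|=j_1+\cdots+j_N$. A local function is the pullback to $J^\infty E$ of a smooth function on some finite jet space $J^kE$ (coordinates $x^i$ and $u_J$, $|J|\le k$); $\mathrm{Loc}(E)$ is the space of local functions. Let $iJ$ be $J$ with its $i$-th entry raised by one, let $$\frac{d}{dx^i}=\frac{\partial}{\partial x^i}+\sum_J u_{iJ}\frac{\partial}{\partial u_J},\qquad \Big(\frac d{d\mathbf x}\Big)^I=\prod_i\Big(\frac d{dx^i}\Big)^{i_i},\qquad \Big(\frac\partial{\partial\mathbf u}\Big)^\alpha=\prod_J\Big(\frac{\partial}{\partial u_J}\Big)^{\alpha(J)}$$ for multi-indices $I=(i_1,\dots,i_N)$ and finitely supported functions $\alpha$ from multi-indices to $\mathbf Z_{\ge0}$, and let $\deg_f(\alpha)$ be the maximal $|J|$ with $\alpha(J)\ne0$ ($0$ if $\alpha=0$). Let $\Omega^{k,0}$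 be the space of horizontal $k$-forms $\sum_{|\epsilon|=k} \omega_\epsilon (d\mathbf x)^\epsilon$ with $\omega_\epsilon\in\mathrm{Loc}(E)$, and $d_H\omega=\sum_i dx^i\wedge \frac{d}{dx^i}\omega$. An $n$-multilinear local differential operator, $A\in\mathrm{LDO}(n)$, is an $n$-linear map $\mathrm{Loc}(E)^{\otimes n}\to\mathrm{Loc}(E)$ of the form $$A(f_1,\dots,f_n)=\sum p_{I_1,\dots,I_n,\alpha_1,\dots,\alpha_n}\prod_{j=1}^n\Big(\frac d{d\mathbf x}\Big)^{I_j}\Big(\frac\partial{\partial\mathbf u}\Big)^{\alpha_j}f_j$$ with $p_{I_1,\dots,I_n,\alpha_1,\dots,\alpha_n}\in\mathrm{Loc}(E)$ such that, for each $m$, only finitely many nonzero coefficients have $\sum_j\deg_f(\alpha_j)\le m$. Let $d/dx^i_j$ and $\partial/\partial u_{J,j}$ be $d/dx^i$ and $\partial/\partial u_J$ acting on the $j$-th argument, and put $d/dy_1^i=\sum_{j=1}^n d/dx^i_j$ and $d/dy_j^i=d/dx^i_j$ for $2\le j\le n$. Every $A\in\mathrm{LDO}(n)$ can be written in polarized form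 $$A=\sum q_{I_1,\dots,I_n;\alpha_1,\dots,\alpha_n}\Big(\frac d{d\mathbf y_1}\Big)^{I_1}\cdots\Big(\frac d{d\mathbf y_n}\Big)^{I_n}\Big(\frac\partial{\partial\mathbf u_1}\Big)^{\alpha_1}\cdots\Big(\frac\partial{\partial\mathbf u_n}\Big)^{\alpha_n}$$ with the same finiteness condition on $q$, and its characteristic is $$\chi(A)=\sum(-1)^{|I_1|}\Big(\Big(\frac d{d\mathbf x}\Big)^{I_1}q_{I_1,\dots,I_n;\alpha_1,\dots,\alpha_n}\Big)\Big(\frac d{d\mathbf y_2}\Big)^{I_2}\cdots\Big(\frac d{d\mathbf y_n}\Big)^{I_n}\Big(\frac\partial{\partial\mathbf u_1}\Big)^{\alpha_1}\cdots\Big(\frac\partial{\partial\mathbf u_n}\Big)^{\alpha_n}.$$ Let $O^N(n)$ be the space of expressions $A\,dx^1\wedge\cdots\wedge dx^N$ with $A\in\mathrm{LDO}(n)$; its elements are written simply $A$, with $A(f_1,\dots,f_n)$ understood as the form $A(f_1,\dots,f_n)\,dx^1\wedge\cdots\wedge dx^N\in\Omega^{N,0}$. **Proposition.** Let $A\in O^N(n)$.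 Then $A(f_1,\dots,f_n)\in d_H(\Omega^{N-1,0})$ for all $f_1,\dots,f_n\in\mathrm{Loc}(E)$ if and only if $\chi(A)=0$. -/

import Mathlib

open scoped ContDiff

noncomputable section

namespace HorizontalLDO

/-- Multi-indices `J = (j₁, …, j_N)` of non-negative integers. -/
abbrev MIdx (N : ℕ) : Type := Fin N → ℕ

/-- The order `|J| = j₁ + ⋯ + j_N`. -/
def order {N : ℕ} (J : MIdx N) : ℕ := ∑ i, J i

/-- The multi-index `iJ`, in which the `i`-th entry of `J` is raised by one. -/
def raise {N : ℕ} (i : Fin N) (J : MIdx N) : MIdx N := J + Pi.single i 1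

/-- The multi-indices of order at most `k`. -/
def idxUpTo (N k : ℕ) : Finset (MIdx N) :=
  (Fintype.piFinset fun _ : Fin N => Finset.range (k + 1)).filter fun J => order J ≤ k

theorem mem_idxUpTo {N k : ℕ} {J : MIdx N} : J ∈ idxUpTo N k ↔ order J ≤ k := by
  simp only [idxUpTo, Finset.mem_filter, Fintype.mem_piFinset, Finset.mem_range,
    and_iff_right_iff_imp]
  intro h i
  have : J i ≤ order J := Finset.single_le_sum (f := J) (fun _ _ => Nat.zero_le _)
    (Finset.mem_univ i)
  omega

/-- The infinite jet space of the trivial line bundle `ℝ^N × ℝ → ℝ^N`, with coordinates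
`(x^i, u_J)`. -/
abbrev Jet (N : ℕ) : Type := (Fin N → ℝ) × (MIdx N → ℝ)

/-- The space of `k`-jets, with coordinates `x^i` and `u_J`, `|J| ≤ k`. -/
abbrev JetK (N k : ℕ) : Type := (Fin N → ℝ) × (idxUpTo N k → ℝ)

/-- The projection from infinite jets to `k`-jets. -/
def proj (N k : ℕ) : Jet N →ₗ[ℝ] JetK N k :=
  LinearMap.prodMap LinearMap.id (LinearMap.funLeft ℝ ℝ (Subtype.val : idxUpTo N k → MIdx N))

/-- `f` is the pullback of a smooth function on the space of `k`-jets. -/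
def HasOrder {N : ℕ} (k : ℕ) (f : Jet N → ℝ) : Prop :=
  ∃ g : JetK N k → ℝ, ContDiff ℝ ∞ g ∧ ∀ z, f z = g (proj N k z)

theorem HasOrder.mono {N k l : ℕ} (h : k ≤ l) {f : Jet N → ℝ} (hf : HasOrder k f) :
    HasOrder l f := by
  obtain ⟨g, hg, hfg⟩ := hf
  have hsub : ∀ J : idxUpTo N k, (J : MIdx N) ∈ idxUpTo N l := fun J =>
    mem_idxUpTo.2 ((mem_idxUpTo.1 J.2).trans h)
  refine ⟨fun w => g (w.1, fun J => w.2 ⟨J, hsub J⟩), ?_, fun z => hfg z⟩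
  exact hg.comp (contDiff_fst.prodMk (contDiff_pi.2 fun J =>
    (contDiff_apply ℝ ℝ (⟨J, hsub J⟩ : idxUpTo N l)).comp contDiff_snd))

/-- The algebra `Loc(E)` of local functions: pullbacks to the infinite jet space of smooth
functions on some space of finite jets. -/
def Loc (N : ℕ) : Subalgebra ℝ (Jet N → ℝ) where
  carrier := {f | ∃ k, HasOrder k f}
  mul_mem' := by
    rintro a b ⟨k, ha⟩ ⟨l, hb⟩
    obtain ⟨g, hg, hag⟩ := ha.mono (le_max_left k l)
    obtain ⟨g', hg', hbg⟩ := hb.mono (le_max_right k l)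
    exact ⟨max k l, fun w => g w * g' w, hg.mul hg', fun z => by simp [hag, hbg]⟩
  add_mem' := by
    rintro a b ⟨k, ha⟩ ⟨l, hb⟩
    obtain ⟨g, hg, hag⟩ := ha.mono (le_max_left k l)
    obtain ⟨g', hg', hbg⟩ := hb.mono (le_max_right k l)
    exact ⟨max k l, fun w => g w + g' w, hg.add hg', fun z => by simp [hag, hbg]⟩
  algebraMap_mem' r := ⟨0, fun _ => r, contDiff_const, fun _ => rfl⟩

theorem HasOrder.hasLineDerivAt {N k : ℕ} {f : Jet N → ℝ} {g : JetK N k → ℝ}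
    (hg : ContDiff ℝ ∞ g) (hfg : ∀ z, f z = g (proj N k z)) (v z : Jet N) :
    HasLineDerivAt ℝ f (fderiv ℝ g (proj N k z) (proj N k v)) z v := by
  have h := ((hg.differentiable (by simp)) (proj N k z)).hasFDerivAt.hasLineDerivAt (proj N k v)
  unfold HasLineDerivAt at h ⊢
  simpa only [hfg, map_add, map_smul] using h

theorem HasOrder.lineDeriv {N k : ℕ} {f : Jet N → ℝ} (hf : HasOrder k f) (v : Jet N) :
    HasOrder k (fun z => lineDeriv ℝ f z v) := by
  obtain ⟨g, hg, hfg⟩ := hf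
  refine ⟨fun w => fderiv ℝ g w (proj N k v), ?_, fun z =>
    (HasOrder.hasLineDerivAt hg hfg v z).lineDeriv⟩
  exact (hg.fderiv_right (m := ∞) (by simp)).clm_apply contDiff_const

theorem HasOrder.lineDifferentiableAt {N k : ℕ} {f : Jet N → ℝ} (hf : HasOrder k f)
    (v z : Jet N) : LineDifferentiableAt ℝ f z v := by
  obtain ⟨g, hg, hfg⟩ := hf
  exact (HasOrder.hasLineDerivAt hg hfg v z).lineDifferentiableAt

/-- The derivative of local functions in a constant direction of the jet space. -/
def dirDeriv {N : ℕ} (v : Jet N) : Module.End ℝ (Loc N) where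
  toFun f := ⟨fun z => lineDeriv ℝ f.1 z v, f.2.imp fun _ h => h.lineDeriv v⟩
  map_add' f g := by
    ext z
    obtain ⟨k, hf⟩ := f.2
    obtain ⟨l, hg⟩ := g.2
    exact deriv_add (hf.lineDifferentiableAt v z) (hg.lineDifferentiableAt v z)
  map_smul' c f := by
    ext z
    obtain ⟨k, hf⟩ := f.2
    exact deriv_const_smul c (hf.lineDifferentiableAt v z)

/-- The partial derivative `∂/∂x^i`. -/
def pdx {N : ℕ} (i : Fin N) : Module.End ℝ (Loc N) := dirDeriv (Pi.single i 1, 0)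

/-- The partial derivative `∂/∂u_J`. -/
def pdu {N : ℕ} (J : MIdx N) : Module.End ℝ (Loc N) := dirDeriv (0, Pi.single J 1)

/-- The coordinate function `u_J`. -/
def uCoord {N : ℕ} (J : MIdx N) : Loc N :=
  ⟨fun z => z.2 J, order J, fun w => w.2 ⟨J, mem_idxUpTo.2 le_rfl⟩,
    (contDiff_apply ℝ ℝ (⟨J, mem_idxUpTo.2 le_rfl⟩ : idxUpTo N (order J))).comp contDiff_snd,
    fun _ => rfl⟩

theorem pdu_eq_zero {N k : ℕ} {f : Loc N} (hf : HasOrder k f.1) {J : MIdx N}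
    (hJ : k < order J) : pdu J f = 0 := by
  obtain ⟨g, hg, hfg⟩ := hf
  ext z
  refine (HasOrder.hasLineDerivAt hg hfg (0, Pi.single J 1) z).lineDeriv.trans ?_
  have : proj N k (0, Pi.single J 1) = 0 := by
    refine Prod.ext rfl (funext fun K => Pi.single_eq_of_ne ?_ _)
    rintro rfl
    exact absurd (mem_idxUpTo.1 K.2) (not_le.2 hJ)
  simp [this]

theorem finite_pdu_ne_zero {N : ℕ} (f : Loc N) : {J : MIdx N | pdu J f ≠ 0}.Finite := by
  obtain ⟨k, hk⟩ := f.2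
  refine (idxUpTo N k).finite_toSet.subset fun J hJ => ?_
  by_contra h
  exact hJ (pdu_eq_zero hk (not_le.1 fun h' => h (mem_idxUpTo.2 h')))

/-- The total derivative `d/dx^i = ∂/∂x^i + ∑_J u_{iJ} ∂/∂u_J`; the sum is finite on each local
function. -/
def totalD {N : ℕ} (i : Fin N) : Module.End ℝ (Loc N) where
  toFun f := pdx i f + ∑ᶠ J, uCoord (raise i J) * pdu J f
  map_add' f g := by
    have hs : ∀ f : Loc N,
        (Function.support fun J => uCoord (raise i J) * pdu J f).Finite := fun f =>
      (finite_pdu_ne_zero f).subset fun J hJ h => hJ (by simp [h])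
    rw [map_add]
    simp only [map_add, mul_add]
    rw [finsum_add_distrib (hs f) (hs g)]
    abel
  map_smul' c f := by
    have hs : (Function.support fun J => uCoord (raise i J) * pdu J f).Finite :=
      (finite_pdu_ne_zero f).subset fun J hJ h => hJ (by simp [h])
    simp only [map_smul, RingHom.id_apply, smul_add, mul_smul_comm]
    rw [smul_finsum' c hs]

/-- `(d/dx)^I = (d/dx^1)^{i₁} ⋯ (d/dx^N)^{i_N}`. -/
def totalDPow {N : ℕ} (I : MIdx N) : Module.End ℝ (Loc N) :=
  (List.ofFn fun i => totalD i ^ I i).prod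

/-- `(∂/∂u)^α = ∏_J (∂/∂u_J)^{α(J)}`, for `α` with finite support. The partial derivatives
commute, so the order in which the factors are listed is immaterial. -/
def pduPow {N : ℕ} (α : MIdx N →₀ ℕ) : Module.End ℝ (Loc N) :=
  (α.support.toList.map fun J => pdu J ^ α J).prod

/-- The formal differential degree of `α`: the maximal order of a multi-index `J` with
`α(J) ≠ 0`, and `0` for `α = 0`. -/
def degf {N : ℕ} (α : MIdx N →₀ ℕ) : ℕ := α.support.sup order

/-- The `n`-linear maps from local functions to local functions. -/
abbrev Multi (N n : ℕ) : Type := MultilinearMap ℝ (fun _ : Fin n => Loc N) (Loc N)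

/-- The indices `(I₁, …, I_n; α₁, …, α_n)` of the terms of an `n`-linear operator. -/
abbrev TermIdx (N n : ℕ) : Type := (Fin n → MIdx N) × (Fin n → MIdx N →₀ ℕ)

/-- The finiteness condition on a family of coefficients: for each `m` only finitely many of the
nonzero ones have `∑_j deg_f(α_j) ≤ m`. -/
def CoeffFinite {N n : ℕ} (p : TermIdx N n → Loc N) : Prop :=
  ∀ m : ℕ, {c : TermIdx N n | ∑ j, degf (c.2 j) ≤ m ∧ p c ≠ 0}.Finite

/-- `A` is an `n`-multilinear local differential operator:
`A(f₁, …, f_n) = ∑ p_{I;α} ∏_j (d/dx)^{I_j} (∂/∂u)^{α_j} f_j`, where the coefficients are local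
functions that satisfy the finiteness condition. -/
def IsLDO {N n : ℕ} (A : Multi N n) : Prop :=
  ∃ p : TermIdx N n → Loc N, CoeffFinite p ∧
    ∀ f : Fin n → Loc N,
      A f = ∑ᶠ c : TermIdx N n, p c * ∏ j, totalDPow (c.1 j) (pduPow (c.2 j) (f j))

/-- The operation `d/dx^i_j`: the total derivative `d/dx^i` acting on the `j`-th argument. -/
def slotD {N n : ℕ} (j : Fin n) (i : Fin N) : Module.End ℝ (Multi N n) :=
  MultilinearMap.compLinearMapₗ
    (Function.update (fun _ => (LinearMap.id : Loc N →ₗ[ℝ] Loc N)) j (totalD i))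

/-- The derivatives in the polarized variables: `d/dy^i_1 = d/dx^i_1 + ⋯ + d/dx^i_n` for the first
argument (which has index `0` here), and `d/dy^i_j = d/dx^i_j` for the others. -/
def polD {N n : ℕ} [NeZero n] (j : Fin n) (i : Fin N) : Module.End ℝ (Multi N n) :=
  if j = 0 then ∑ k, slotD k i else slotD j i

/-- `(d/dy_1)^{I₁} ⋯ (d/dy_n)^{I_n}`. -/
def polDPow {N n : ℕ} [NeZero n] (I : Fin n → MIdx N) : Module.End ℝ (Multi N n) :=
  (List.ofFn fun j => (List.ofFn fun i => polD j i ^ I j i).prod).prod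

/-- The `n`-linear operator `(d/dy_1)^{I₁} ⋯ (d/dy_n)^{I_n} (∂/∂u_1)^{α₁} ⋯ (∂/∂u_n)^{α_n}`, with the
results multiplied together. -/
def polTerm {N n : ℕ} [NeZero n] (I : Fin n → MIdx N) (α : Fin n → MIdx N →₀ ℕ) : Multi N n :=
  (polDPow I (MultilinearMap.mkPiAlgebra ℝ (Fin n) (Loc N))).compLinearMap fun j => pduPow (α j)

/-- The coefficients `q` give a polarized form of `A`:
`A = ∑ q_{I;α} (d/dy_1)^{I₁} ⋯ (d/dy_n)^{I_n} (∂/∂u_1)^{α₁} ⋯ (∂/∂u_n)^{α_n}`. -/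
def IsPolarizedForm {N n : ℕ} [NeZero n] (A : Multi N n) (q : TermIdx N n → Loc N) : Prop :=
  CoeffFinite q ∧ ∀ f : Fin n → Loc N, A f = ∑ᶠ c : TermIdx N n, q c * polTerm c.1 c.2 f

theorem HasOrder.pdu {N k : ℕ} {f : Loc N} (hf : HasOrder k f.1) (J : MIdx N) (m : ℕ) :
    HasOrder k ((pdu J ^ m) f).1 := by
  induction m with
  | zero => simpa using hf
  | succ m ih => rw [pow_succ']; exact ih.lineDeriv _

theorem pduPow_eq_zero {N k : ℕ} {α : MIdx N →₀ ℕ} (hα : k < degf α) {f : Loc N}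
    (hf : HasOrder k f.1) : pduPow α f = 0 := by
  obtain ⟨J, hJ, hkJ⟩ := Finset.lt_sup_iff.1 hα
  have key : ∀ l : List (MIdx N), J ∈ l → (l.map fun K => pdu K ^ α K).prod f = 0 := by
    have ord : ∀ l : List (MIdx N), HasOrder k ((l.map fun K => pdu K ^ α K).prod f).1 := by
      intro l
      induction l with
      | nil => simpa using hf
      | cons K l ih => simpa using ih.pdu K (α K)
    intro l
    induction l with
    | nil => simp
    | cons K l ih =>
      intro h
      rw [List.map_cons, List.prod_cons, Module.End.mul_apply]
      rcases List.mem_cons.1 h with rfl | h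
      · obtain ⟨m, hm⟩ := Nat.exists_eq_succ_of_ne_zero (Finsupp.mem_support_iff.1 hJ)
        rw [hm, pow_succ, Module.End.mul_apply, pdu_eq_zero (ord l) hkJ, map_zero]
      · rw [ih h, map_zero]
  exact key _ (Finset.mem_toList.2 hJ)

/-- The family of terms `(-1)^{|I₁|} ((d/dx)^{I₁} q_{I;α}) (d/dy_2)^{I₂} ⋯ (d/dy_n)^{I_n}
(∂/∂u_1)^{α₁} ⋯ (∂/∂u_n)^{α_n}`. -/
def charTerm {N n : ℕ} [NeZero n] (q : TermIdx N n → Loc N) (c : TermIdx N n) : Multi N n :=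
  ((-1 : Loc N) ^ order (c.1 0) * totalDPow (c.1 0) (q c)) •
    polTerm (Function.update c.1 0 0) c.2

theorem finite_charTerm_ne_zero {N n : ℕ} [NeZero n] {q : TermIdx N n → Loc N}
    (hq : CoeffFinite q) (f : Fin n → Loc N) :
    (Function.support fun c => charTerm q c f).Finite := by
  choose k hk using fun j => (f j).2
  refine (hq (∑ j, k j)).subset fun c hc => ⟨?_, fun h => hc ?_⟩
  · refine Finset.sum_le_sum fun j _ => ?_
    by_contra h
    refine hc ?_
    have h0 : pduPow (c.2 j) (f j) = 0 := pduPow_eq_zero (not_le.1 h) (hk j)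
    have h1 : polTerm (Function.update c.1 0 0) c.2 f = 0 := by
      rw [polTerm, MultilinearMap.compLinearMap_apply]
      exact MultilinearMap.map_coord_zero _ j h0
    simp [charTerm, h1]
  · simp [charTerm, h]

/-- The sum of the terms of the characteristic, for given coefficients of a polarized form. The
sum is finite on each `n`-tuple of local functions. -/
def charSum {N n : ℕ} [NeZero n] (q : TermIdx N n → Loc N) (hq : CoeffFinite q) : Multi N n where
  toFun f := ∑ᶠ c : TermIdx N n, charTerm q c f
  map_update_add' f j a b := by
    simp only [MultilinearMap.map_update_add]
    exact finsum_add_distrib (finite_charTerm_ne_zero hq _) (finite_charTerm_ne_zero hq _)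
  map_update_smul' f j r a := by
    simp only [MultilinearMap.map_update_smul]
    exact (smul_finsum' r (finite_charTerm_ne_zero hq _)).symm

open Classical in
/-- The characteristic `χ(A) = ∑ (-1)^{|I₁|} ((d/dx)^{I₁} q_{I;α}) (d/dy_2)^{I₂} ⋯ (d/dy_n)^{I_n}
(∂/∂u_1)^{α₁} ⋯ (∂/∂u_n)^{α_n}`, where `q` are the coefficients of the polarized form of `A`. Each
local differential operator has exactly one polarized form; the value `0` for maps that have none
is a convention. -/
def characteristic {N n : ℕ} [NeZero n] (A : Multi N n) : Multi N n :=
  if h : ∃ q, IsPolarizedForm A q then charSum h.choose h.choose_spec.1 else 0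

/-- Horizontal forms `∑_ε η_ε (dx)^ε` on the jet space with local coefficients. The increasing
product `(dx)^ε` is indexed by the set `S` of the `i` with `ε^i = 1`. -/
abbrev HForm (N : ℕ) : Type := Finset (Fin N) → Loc N

/-- The space `Ω^{k,0}` of horizontal `k`-forms. -/
def horizontal (N k : ℕ) : Submodule ℝ (HForm N) where
  carrier := {η | ∀ S, S.card ≠ k → η S = 0}
  add_mem' ha hb S hS := by simp [ha S hS, hb S hS]
  zero_mem' _ _ := rfl
  smul_mem' r _ ha S hS := by simp [ha S hS]

/-- The horizontal differential `d_H η = ∑_i dx^i ∧ (d/dx^i) η`. In the coefficient of `(dx)^S` the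
`i`-th term is `(d/dx^i) η_{S \ {i}}`, with the sign of `dx^i ∧ (dx)^{S \ {i}} = ± (dx)^S`. -/
def dH {N : ℕ} (η : HForm N) : HForm N := fun S =>
  ∑ i ∈ S, (-1 : Loc N) ^ (S.filter (· < i)).card * totalD i (η (S.erase i))

/-- The space `O^k(n)` of horizontal `k`-forms whose coefficients are `n`-multilinear local
differential operators. -/
structure OpForm (N n k : ℕ) where
  coeff : Finset (Fin N) → Multi N n
  isLDO : ∀ S, IsLDO (coeff S)
  coeff_eq_zero : ∀ S, S.card ≠ k → coeff S = 0

/-- The value `A(f₁, …, f_n)`, a horizontal form. -/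
def OpForm.eval {N n k : ℕ} (A : OpForm N n k) (f : Fin n → Loc N) : HForm N :=
  fun S => A.coeff S f

/-- The identification `A dx^1 ∧ ⋯ ∧ dx^N ↦ A` of top degree operator forms with operators. -/
def OpForm.top {N n : ℕ} (A : OpForm N n N) : Multi N n := A.coeff Finset.univ

end HorizontalLDO

end

namespace HorizontalLDO

variable {N : ℕ}

/-! In top degree, exactness means that the single coefficient is a total divergence `∑ i, totalD i
(h i)` (`exists_dH_eq_iff`). Polarization turns the sum of the derivatives over all slots into a
total derivative of the whole term, so integrating by parts term by term shows that `A f` and `χ(A)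
f` differ by a total divergence (`apply_sub_charSum_mem_totalDivergences`). This gives the direction
from `χ(A) = 0`, and reduces the converse to showing that `χ(A)` vanishes once all its values are
divergences (`charSum_eq_zero`).

No total derivative in `χ(A)` hits the first argument; only the `∂/∂u_J` do. Hence `χ(A)` is linear
over functions `a(x)` in that argument, and `a * χ(A) f` is a divergence for every such `a`. The
Euler operator kills divergences (`euler_totalD`), so `∑ (-1)^|J| (d/dx)^J (a ∂g/∂u_J) = 0` with `g
= χ(A) f`. Commuting with the `x^i` strips off derivatives until every `∂g/∂u_J` is seen to vanish
(`eq_zero_of_sum_totalDPow_mul_eq_zero`), so `g` depends on `x` alone. But `χ(A)` is also local in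
`u` in its first argument: splitting `f 0` by a cutoff in `u` gives two pieces whose values vanish
on different ranges of `u`. Being constant in `u`, both values are zero. -/

/-! ### Partial derivatives and coordinate functions. -/

theorem dirDeriv_mul (v : Jet N) (f g : Loc N) :
    dirDeriv v (f * g) = dirDeriv v f * g + f * dirDeriv v g := by
  ext z
  obtain ⟨k, hf⟩ := f.2
  obtain ⟨l, hg⟩ := g.2
  have h := deriv_fun_mul (hf.lineDifferentiableAt v z) (hg.lineDifferentiableAt v z)
  simpa [dirDeriv, lineDeriv] using h

theorem dirDeriv_one (v : Jet N) : dirDeriv v (1 : Loc N) = 0 := by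
  have h := dirDeriv_mul v (1 : Loc N) 1
  simpa using h

/-- Symmetry of the second derivative of the smooth function on a finite jet space that represents
`f`. -/
theorem dirDeriv_comm (v w : Jet N) (f : Loc N) :
    dirDeriv v (dirDeriv w f) = dirDeriv w (dirDeriv v f) := by
  obtain ⟨k, g, hg, hfg⟩ := f.2
  have h1 : ∀ v z, (dirDeriv v f).1 z = fderiv ℝ g (proj N k z) (proj N k v) := fun v z =>
    (HasOrder.hasLineDerivAt hg hfg v z).lineDeriv
  have hd : ContDiff ℝ ∞ (fderiv ℝ g) := hg.fderiv_right (m := ∞) (by simp)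
  have h2 : ∀ v w z, (dirDeriv v (dirDeriv w f)).1 z =
      fderiv ℝ (fderiv ℝ g) (proj N k z) (proj N k v) (proj N k w) := by
    intro v w z
    have hc : ContDiff ℝ ∞ fun y => fderiv ℝ g y (proj N k w) := hd.clm_apply contDiff_const
    refine (HasOrder.hasLineDerivAt hc (h1 w) v z).lineDeriv.trans ?_
    rw [fderiv_clm_apply (hd.differentiable (by simp) _) (differentiableAt_const _)]
    simp
  ext z
  rw [h2, h2]
  exact ((contDiff_infty.1 hg 2).contDiffAt.isSymmSndFDerivAt (by simp)) _ _

/-- For small `t` the line `z + t • v` stays in the open slab, so the derivative is that of a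
locally zero function. -/
theorem dirDeriv_apply_eq_zero {v : Jet N} {f : Loc N} {z : Jet N} {s : Set ℝ} (hs : IsOpen s)
    {J : MIdx N} (hf : ∀ y : Jet N, y.2 J ∈ s → f.1 y = 0) (hz : z.2 J ∈ s) :
    (dirDeriv v f).1 z = 0 := by
  have hev : (fun t : ℝ => f.1 (z + t • v)) =ᶠ[nhds 0] fun _ => 0 := by
    have hc : Continuous fun t : ℝ => (z + t • v).2 J := by
      simp only [Prod.snd_add, Prod.smul_snd, Pi.add_apply, Pi.smul_apply, smul_eq_mul]
      fun_prop
    filter_upwards [(hs.preimage hc).mem_nhds (by simpa using hz)] with t ht using hf _ ht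
  exact hev.deriv_eq.trans (by simp)

theorem pdu_mul (J : MIdx N) (f g : Loc N) : pdu J (f * g) = pdu J f * g + f * pdu J g :=
  dirDeriv_mul _ f g

theorem pdx_mul (i : Fin N) (f g : Loc N) : pdx i (f * g) = pdx i f * g + f * pdx i g :=
  dirDeriv_mul _ f g

theorem pdu_pdu (J K : MIdx N) (f : Loc N) : pdu J (pdu K f) = pdu K (pdu J f) :=
  dirDeriv_comm _ _ f

theorem pdu_pdx (J : MIdx N) (i : Fin N) (f : Loc N) : pdu J (pdx i f) = pdx i (pdu J f) :=
  dirDeriv_comm _ _ f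

theorem pdx_pdx (i j : Fin N) (f : Loc N) : pdx i (pdx j f) = pdx j (pdx i f) :=
  dirDeriv_comm _ _ f

theorem dirDeriv_uCoord (v : Jet N) (J : MIdx N) :
    dirDeriv v (uCoord J) = algebraMap ℝ (Loc N) (v.2 J) := by
  ext z
  have h : HasDerivAt (fun t : ℝ => z.2 J + t * v.2 J) (1 * v.2 J) 0 :=
    ((hasDerivAt_id (0 : ℝ)).mul_const (v.2 J)).const_add (z.2 J)
  exact h.deriv.trans (one_mul _)

theorem pdu_uCoord (J K : MIdx N) : pdu J (uCoord K) = if K = J then 1 else 0 := by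
  rw [pdu, dirDeriv_uCoord]
  by_cases h : K = J <;> simp [h]

theorem pdx_uCoord (i : Fin N) (K : MIdx N) : pdx i (uCoord K) = 0 := by
  rw [pdx, dirDeriv_uCoord]
  simp

/-- The coordinate function `x^i`. -/
noncomputable def xCoord (i : Fin N) : Loc N :=
  ⟨fun z => z.1 i, 0, fun w => w.1 i, (contDiff_apply ℝ ℝ i).comp contDiff_fst, fun _ => rfl⟩

theorem dirDeriv_xCoord (v : Jet N) (i : Fin N) :
    dirDeriv v (xCoord i) = algebraMap ℝ (Loc N) (v.1 i) := by
  ext z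
  have h : HasDerivAt (fun t : ℝ => z.1 i + t * v.1 i) (1 * v.1 i) 0 :=
    ((hasDerivAt_id (0 : ℝ)).mul_const (v.1 i)).const_add (z.1 i)
  exact h.deriv.trans (one_mul _)

theorem pdu_xCoord (J : MIdx N) (i : Fin N) : pdu J (xCoord i) = 0 := by
  rw [pdu, dirDeriv_xCoord]
  simp

theorem pdx_xCoord (i j : Fin N) : pdx i (xCoord j) = if j = i then 1 else 0 := by
  rw [pdx, dirDeriv_xCoord]
  by_cases h : j = i <;> simp [h]

/-! ### Order of local functions and the algebra of total derivatives. -/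

/-- The partial derivatives of `f` with respect to the `u_J`, `|J| > k`, vanish. -/
def OrderLE (k : ℕ) (f : Loc N) : Prop := ∀ J, k < order J → pdu J f = 0

theorem exists_orderLE (f : Loc N) : ∃ k, OrderLE k f := by
  obtain ⟨k, hk⟩ := f.2
  exact ⟨k, fun J hJ => pdu_eq_zero hk hJ⟩

theorem OrderLE.mono {k l : ℕ} {f : Loc N} (h : OrderLE k f) (hkl : k ≤ l) : OrderLE l f :=
  fun J hJ => h J (hkl.trans_lt hJ)

theorem OrderLE.pdu {k : ℕ} {f : Loc N} (h : OrderLE k f) (J : MIdx N) : OrderLE k (pdu J f) :=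
  fun K hK => by rw [pdu_pdu, h K hK, map_zero]

theorem OrderLE.pdx {k : ℕ} {f : Loc N} (h : OrderLE k f) (i : Fin N) : OrderLE k (pdx i f) :=
  fun K hK => by rw [pdu_pdx, h K hK, map_zero]

theorem OrderLE.mul {k : ℕ} {f g : Loc N} (hf : OrderLE k f) (hg : OrderLE k g) :
    OrderLE k (f * g) :=
  fun K hK => by rw [pdu_mul, hf K hK, hg K hK]; simp

theorem OrderLE.totalD_eq {k : ℕ} {f : Loc N} (h : OrderLE k f) (i : Fin N) :
    totalD i f = HorizontalLDO.pdx i f +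
      ∑ J ∈ idxUpTo N k, uCoord (raise i J) * HorizontalLDO.pdu J f := by
  change HorizontalLDO.pdx i f + ∑ᶠ J, uCoord (raise i J) * HorizontalLDO.pdu J f = _
  rw [finsum_eq_sum_of_support_subset]
  intro J hJ
  by_contra hJ'
  exact hJ (by
    change _ * _ = _
    rw [h J (not_le.1 fun hk => hJ' (mem_idxUpTo.2 hk)), mul_zero])

theorem totalD_mul (i : Fin N) (f g : Loc N) :
    totalD i (f * g) = totalD i f * g + f * totalD i g := by
  obtain ⟨k, hf⟩ := exists_orderLE f
  obtain ⟨l, hg⟩ := exists_orderLE g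
  replace hf := hf.mono (le_max_left k l)
  replace hg := hg.mono (le_max_right k l)
  rw [(hf.mul hg).totalD_eq, hf.totalD_eq, hg.totalD_eq]
  simp only [pdu_mul, pdx_mul, mul_add, add_mul, Finset.sum_add_distrib, Finset.sum_mul,
    Finset.mul_sum]
  have h1 : ∀ J, uCoord (raise i J) * (f * pdu J g) = f * (uCoord (raise i J) * pdu J g) :=
    fun J => by ring
  simp only [h1, mul_assoc]
  abel

theorem totalD_uCoord (i : Fin N) (J : MIdx N) : totalD i (uCoord J) = uCoord (raise i J) := by
  have h : OrderLE (order J) (uCoord J) := fun K hK => by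
    rw [pdu_uCoord, if_neg]
    rintro rfl
    exact lt_irrefl _ hK
  rw [h.totalD_eq, pdx_uCoord, zero_add]
  simp [pdu_uCoord, mem_idxUpTo]

theorem totalD_xCoord (i j : Fin N) : totalD i (xCoord j) = if j = i then 1 else 0 := by
  have h : OrderLE 0 (xCoord j) := fun K _ => pdu_xCoord K j
  rw [h.totalD_eq, pdx_xCoord]
  simp [pdu_xCoord]

theorem order_raise (i : Fin N) (J : MIdx N) : order (raise i J) = order J + 1 := by
  simp [order, raise, Finset.sum_add_distrib]

theorem raise_injective (i : Fin N) : Function.Injective (raise i) :=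
  fun _ _ h => add_right_cancel h

theorem raise_comm (i j : Fin N) (J : MIdx N) : raise i (raise j J) = raise j (raise i J) := by
  simp only [raise, add_right_comm]

theorem exists_eq_raise {i : Fin N} {J : MIdx N} (h : J i ≠ 0) : ∃ K, raise i K = J := by
  refine ⟨J - Pi.single i 1, funext fun l => ?_⟩
  by_cases hl : l = i
  · subst hl
    simp [raise]
    omega
  · simp [raise, hl]

theorem raise_apply_ne_zero (i : Fin N) (J : MIdx N) : raise i J i ≠ 0 := by simp [raise]

theorem MIdx.induction {P : MIdx N → Prop} (zero : P 0) (step : ∀ i J, P J → P (raise i J))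
    (J : MIdx N) : P J := by
  induction h : order J generalizing J with
  | zero =>
    have : J = 0 := funext fun i => (Finset.sum_eq_zero_iff.1 h) i (Finset.mem_univ i)
    exact this ▸ zero
  | succ k ih =>
    obtain ⟨i, -, hi⟩ : ∃ i ∈ Finset.univ, J i ≠ 0 :=
      Finset.exists_ne_zero_of_sum_ne_zero (s := Finset.univ) (f := J) (by
        change order J ≠ 0; omega)
    obtain ⟨K, rfl⟩ := exists_eq_raise hi
    rw [order_raise] at h
    exact step i K (ih K (by omega))

theorem sum_idxUpTo_succ {M : Type*} [AddCommMonoid M] (i : Fin N) (k : ℕ) {F : MIdx N → M}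
    (hF : ∀ J, J i = 0 → F J = 0) :
    ∑ J ∈ idxUpTo N (k + 1), F J = ∑ J ∈ idxUpTo N k, F (raise i J) := by
  symm
  refine (Finset.sum_map (idxUpTo N k) ⟨raise i, raise_injective i⟩ F).symm.trans ?_
  refine Finset.sum_subset (fun J hJ => ?_) fun J hJ hJ' => hF J ?_
  · obtain ⟨K, hK, rfl⟩ := Finset.mem_map.1 hJ
    rw [mem_idxUpTo] at hK ⊢
    change order (raise i K) ≤ _
    rw [order_raise]
    omega
  · by_contra h
    obtain ⟨K, rfl⟩ := exists_eq_raise h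
    rw [mem_idxUpTo, order_raise] at hJ
    exact hJ' (Finset.mem_map.2 ⟨K, mem_idxUpTo.2 (by omega), rfl⟩)

/-- The commutator comes from differentiating the coefficients `u_{iK}` of `totalD i`; at most one
`K` contributes, since `raise i` is injective. -/
theorem pdu_totalD (i : Fin N) (J : MIdx N) (f : Loc N) :
    pdu J (totalD i f) =
      totalD i (pdu J f) + ∑ᶠ K, if raise i K = J then pdu K f else 0 := by
  obtain ⟨k, hf⟩ := exists_orderLE f
  rw [hf.totalD_eq, (hf.pdu J).totalD_eq, map_add, map_sum, pdu_pdx,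
    finsum_eq_sum_of_support_subset (s := idxUpTo N k)]
  · simp only [pdu_mul, pdu_uCoord, Finset.sum_add_distrib, ite_mul, one_mul, zero_mul,
      pdu_pdu J]
    abel
  · intro K hK
    by_contra hK'
    refine hK ?_
    change ite _ _ _ = _
    rw [hf K (not_le.1 fun hk => hK' (mem_idxUpTo.2 hk)), ite_self]

theorem pdu_raise_totalD (i : Fin N) (J : MIdx N) (f : Loc N) :
    pdu (raise i J) (totalD i f) = totalD i (pdu (raise i J) f) + pdu J f := by
  rw [pdu_totalD, finsum_eq_single _ J, if_pos rfl]
  exact fun K hK => if_neg fun h => hK (raise_injective i h)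

theorem pdu_totalD_of_eq_zero {i : Fin N} {J : MIdx N} (hJ : J i = 0) (f : Loc N) :
    pdu J (totalD i f) = totalD i (pdu J f) := by
  rw [pdu_totalD, finsum_eq_zero_of_forall_eq_zero, add_zero]
  intro K
  refine if_neg ?_
  rintro rfl
  exact raise_apply_ne_zero i K hJ

theorem OrderLE.totalD {k : ℕ} {f : Loc N} (h : OrderLE k f) (i : Fin N) :
    OrderLE (k + 1) (totalD i f) := by
  intro J hJ
  by_cases h0 : J i = 0
  · rw [pdu_totalD_of_eq_zero h0, h J (by omega), map_zero]
  · obtain ⟨K, rfl⟩ := exists_eq_raise h0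
    rw [order_raise] at hJ
    rw [pdu_raise_totalD, h K (by omega), h _ (by rw [order_raise]; omega), map_zero, add_zero]

theorem totalD_comm (i j : Fin N) : Commute (totalD i) (totalD j) := by
  refine LinearMap.ext fun f => ?_
  obtain ⟨k, hf⟩ := exists_orderLE f
  -- Full expansion in partial derivatives: exchanging `i` and `j` only permutes the summands.
  have key : ∀ i j : Fin N, totalD i (totalD j f) =
      pdx i (pdx j f) + ∑ J ∈ idxUpTo N k, uCoord (raise i J) * pdx j (pdu J f)
        + ∑ J ∈ idxUpTo N k, uCoord (raise i (raise j J)) * pdu J f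
        + ∑ J ∈ idxUpTo N k, uCoord (raise j J) * pdx i (pdu J f)
        + ∑ J ∈ idxUpTo N k, ∑ K ∈ idxUpTo N k,
            uCoord (raise i K) * uCoord (raise j J) * pdu K (pdu J f) := by
    intro i j
    rw [hf.totalD_eq j, map_add, map_sum, (hf.pdx j).totalD_eq]
    simp only [totalD_mul, totalD_uCoord, (hf.pdu _).totalD_eq, mul_add, Finset.mul_sum,
      Finset.sum_add_distrib, pdu_pdx]
    have h1 : ∀ J K, uCoord (raise j J) * (uCoord (raise i K) * pdu K (pdu J f)) =
      uCoord (raise i K) * uCoord (raise j J) * pdu K (pdu J f) := fun J K => by ring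
    simp only [h1]
    abel
  change totalD i (totalD j f) = totalD j (totalD i f)
  rw [key i j, key j i, pdx_pdx i j, Finset.sum_comm (s := idxUpTo N k) (t := idxUpTo N k)]
  have h1 : ∀ J K : MIdx N, uCoord (raise i J) * uCoord (raise j K) * pdu J (pdu K f) =
      uCoord (raise j K) * uCoord (raise i J) * pdu K (pdu J f) := fun J K => by
    rw [pdu_pdu J K]; ring
  simp only [h1, raise_comm i j]
  abel

/-! ### Powers of total derivatives. -/

theorem prod_ofFn_update_mul {M : Type*} [Monoid M] {m : ℕ} (F : Fin m → M) (a : M)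
    (ha : ∀ i, Commute a (F i)) (k : Fin m) :
    (List.ofFn (Function.update F k (a * F k))).prod = a * (List.ofFn F).prod := by
  induction m with
  | zero => exact k.elim0
  | succ m ih =>
    rw [List.ofFn_succ, List.ofFn_succ, List.prod_cons, List.prod_cons]
    induction k using Fin.cases with
    | zero => simp [mul_assoc]
    | succ k =>
      have h := ih (fun i => F i.succ) (fun i => ha _) k
      have e : (fun i : Fin m => Function.update F k.succ (a * F k.succ) i.succ) =
          Function.update (fun i => F i.succ) k (a * F k.succ) :=
        Function.update_comp_eq_of_injective F (Fin.succ_injective m) k (a * F k.succ)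
      rw [e, h, Function.update_of_ne (Fin.succ_ne_zero k).symm, ← mul_assoc, ← mul_assoc,
        (ha 0).eq]

theorem prod_ofFn_pow_add_single {M : Type*} [Monoid M] {m : ℕ} (T : Fin m → M)
    (hT : ∀ i j, Commute (T i) (T j)) (I : Fin m → ℕ) (k : Fin m) :
    (List.ofFn fun i => T i ^ (I + Pi.single k 1 : Fin m → ℕ) i).prod =
      T k * (List.ofFn fun i => T i ^ I i).prod := by
  rw [← prod_ofFn_update_mul _ _ (fun i => (hT k i).pow_right (I i)) k]
  congr 2
  funext i
  by_cases hi : i = k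
  · subst hi
    simp [pow_succ']
  · simp [hi]

theorem totalDPow_zero : totalDPow (0 : MIdx N) = 1 := by
  simp only [totalDPow, Pi.zero_apply, pow_zero, List.ofFn_const, List.prod_replicate, one_pow]

theorem totalDPow_raise (i : Fin N) (J : MIdx N) :
    totalDPow (raise i J) = totalD i * totalDPow J :=
  prod_ofFn_pow_add_single _ totalD_comm J i

theorem totalDPow_commute (J : MIdx N) (i : Fin N) : Commute (totalDPow J) (totalD i) := by
  induction J using MIdx.induction with
  | zero => rw [totalDPow_zero]; exact Commute.one_left _
  | step j J ih => rw [totalDPow_raise]; exact (totalD_comm j i).mul_left ih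

/-! ### Total divergences and the Euler operator. -/

/-- The space of total divergences `∑_i (d/dx^i) h_i`. -/
noncomputable def totalDivergences (N : ℕ) : Submodule ℝ (Loc N) :=
  LinearMap.range (∑ i : Fin N, totalD i ∘ₗ LinearMap.proj i : (Fin N → Loc N) →ₗ[ℝ] Loc N)

theorem mem_totalDivergences {g : Loc N} :
    g ∈ totalDivergences N ↔ ∃ h : Fin N → Loc N, ∑ i, totalD i (h i) = g := by
  simp [totalDivergences, LinearMap.mem_range]

theorem totalD_mem_totalDivergences (i : Fin N) (g : Loc N) :
    totalD i g ∈ totalDivergences N := by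
  classical
  refine mem_totalDivergences.2 ⟨Pi.single i g, ?_⟩
  rw [Finset.sum_eq_single i]
  · simp
  · intro j _ hj
    rw [Pi.single_eq_of_ne hj, map_zero]
  · simp

/-- The Euler operator `∑_J (-1)^{|J|} (d/dx)^J ∂/∂u_J`, truncated to `|J| ≤ k`. -/
noncomputable def euler (N k : ℕ) : Module.End ℝ (Loc N) :=
  ∑ J ∈ idxUpTo N k, (-1 : ℝ) ^ order J • (totalDPow J * pdu J)

theorem euler_apply (k : ℕ) (g : Loc N) :
    euler N k g = ∑ J ∈ idxUpTo N k, (-1 : ℝ) ^ order J • totalDPow J (pdu J g) := by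
  simp [euler, LinearMap.sum_apply]

theorem OrderLE.euler_eq {k l : ℕ} {g : Loc N} (h : OrderLE k g) (hkl : k ≤ l) :
    HorizontalLDO.euler N l g = HorizontalLDO.euler N k g := by
  rw [euler_apply, euler_apply]
  symm
  refine Finset.sum_subset (fun J hJ => ?_) fun J _ hJ => ?_
  · rw [mem_idxUpTo] at hJ ⊢
    omega
  · rw [mem_idxUpTo, not_le] at hJ
    rw [h J hJ, map_zero, smul_zero]

/-- The sum telescopes: the commutator term of `∂/∂u_{iJ}` with `totalD i` cancels the main term at
`J`, because the sign changes with the order. The truncation is `k + 1` since `totalD i` raises the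
order by one. -/
theorem euler_totalD {k : ℕ} {h : Loc N} (hh : OrderLE k h) (i : Fin N) :
    euler N (k + 1) (totalD i h) = 0 := by
  -- Main term plus commutator; the latter vanishes unless `J` lies in the range of `raise i`.
  have hpdu : ∀ J, pdu J (totalD i h) =
      totalD i (pdu J h) +
        (pdu J (totalD i h) -
          totalD i (pdu J h)) := fun J => by abel
  rw [euler_apply]
  simp only [fun J => congrArg (fun g => (-1 : ℝ) ^ order J • totalDPow J g) (hpdu J),
    map_add, smul_add, Finset.sum_add_distrib]
  rw [sum_idxUpTo_succ i k (F := fun J => (-1 : ℝ) ^ order J • totalDPow J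
    (pdu J (totalD i h) -
      totalD i (pdu J h)))]
  · have h1 : ∑ J ∈ idxUpTo N (k + 1), (-1 : ℝ) ^ order J •
        totalDPow J (totalD i (pdu J h)) =
        ∑ J ∈ idxUpTo N k, (-1 : ℝ) ^ order J •
          totalDPow J (totalD i (pdu J h)) := by
      symm
      refine Finset.sum_subset (fun J hJ => ?_) fun J _ hJ => ?_
      · rw [mem_idxUpTo] at hJ ⊢
        omega
      · rw [mem_idxUpTo, not_le] at hJ
        rw [hh J hJ, map_zero, map_zero, smul_zero]
    rw [h1, ← Finset.sum_add_distrib]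
    refine Finset.sum_eq_zero fun J _ => ?_
    have h2 : totalDPow J (totalD i (pdu J h)) =
        totalD i (totalDPow J (pdu J h)) :=
      LinearMap.congr_fun (totalDPow_commute J i).eq _
    rw [pdu_raise_totalD, add_sub_cancel_left, totalDPow_raise, order_raise, pow_succ, h2]
    simp
  · intro J hJ
    rw [pdu_totalD_of_eq_zero hJ, sub_self, map_zero, smul_zero]

theorem exists_forall_euler_eq_zero {g : Loc N} (hg : g ∈ totalDivergences N) :
    ∃ k, ∀ l, k ≤ l → euler N l g = 0 := by
  obtain ⟨h, rfl⟩ := mem_totalDivergences.1 hg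
  choose k hk using fun i => exists_orderLE (h i)
  refine ⟨(∑ i, k i) + 1, fun l hl => ?_⟩
  rw [map_sum]
  refine Finset.sum_eq_zero fun i _ => ?_
  have hi : k i ≤ ∑ i, k i := Finset.single_le_sum (fun _ _ => Nat.zero_le _) (Finset.mem_univ i)
  rw [((hk i).totalD i).euler_eq (by omega), euler_totalD (hk i)]

/-! ### Functions of `x` as multipliers. -/

/-- Local functions that depend only on `x`. -/
def IsBase (a : Loc N) : Prop := ∀ J, pdu J a = 0

theorem isBase_one : IsBase (1 : Loc N) := fun _ => dirDeriv_one _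

theorem isBase_xCoord (i : Fin N) : IsBase (xCoord i) := fun J => pdu_xCoord J i

theorem IsBase.mul {a b : Loc N} (ha : IsBase a) (hb : IsBase b) : IsBase (a * b) := fun J => by
  rw [pdu_mul, ha J, hb J, zero_mul, mul_zero, add_zero]

theorem IsBase.pdu_mul {a : Loc N} (ha : IsBase a) (J : MIdx N) (g : Loc N) :
    pdu J (a * g) = a * pdu J g := by
  rw [HorizontalLDO.pdu_mul, ha J, zero_mul, zero_add]

/-- The commutator of a differential operator with `x^i` differentiates its symbol: `(d/dx)^{iJ}`
yields `J i + 1` times `(d/dx)^J`, and operators free of `d/dx^i` yield zero. -/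
theorem totalDPow_xCoord_mul (i : Fin N) (J : MIdx N) :
    (J i = 0 → ∀ b, totalDPow J (xCoord i * b) = xCoord i * totalDPow J b) ∧
    ∀ b, totalDPow (raise i J) (xCoord i * b) =
      xCoord i * totalDPow (raise i J) b + (J i + 1 : ℝ) • totalDPow J b := by
  induction J using MIdx.induction with
  | zero =>
    simp [totalDPow_raise, totalDPow_zero, totalD_mul, totalD_xCoord, add_comm]
  | step j J ih =>
    obtain ⟨ih0, ih1⟩ := ih
    by_cases hj : j = i
    · subst hj
      refine ⟨fun h => absurd h (raise_apply_ne_zero j J), fun b => ?_⟩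
      rw [totalDPow_raise j (raise j J), Module.End.mul_apply, ih1 b, map_add, totalD_mul,
        totalD_xCoord, if_pos rfl, map_smul, ← Module.End.mul_apply (totalD j) (totalDPow J),
        ← totalDPow_raise, Module.End.mul_apply]
      have : ((raise j J j : ℕ) : ℝ) = J j + 1 := by simp [raise]
      rw [this, one_mul]
      module
    · have hji : raise j J i = J i := by simp [raise, Ne.symm hj]
      have hx : totalD j (xCoord i) = 0 := by rw [totalD_xCoord, if_neg (Ne.symm hj)]
      constructor
      · intro h b
        rw [totalDPow_raise, Module.End.mul_apply, ih0 (hji ▸ h) b, totalD_mul, hx]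
        simp
      · intro b
        rw [raise_comm, totalDPow_raise j, Module.End.mul_apply, ih1 b, map_add, totalD_mul, hx,
          map_smul, hji, totalDPow_raise j J]
        simp

/-- Induction on `k`: taking the commutator with `x^i` lowers the order of the operator by one, and
the inductive hypothesis kills every coefficient with `J ≠ 0`. The choice `a = 1` then leaves only
`h 0`. -/
theorem eq_zero_of_sum_totalDPow_mul_eq_zero (k : ℕ) (h : MIdx N → Loc N)
    (H : ∀ a, IsBase a → ∑ J ∈ idxUpTo N k, totalDPow J (a * h J) = 0) :
    ∀ J ∈ idxUpTo N k, h J = 0 := by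
  induction k generalizing h with
  | zero =>
    have h0 : idxUpTo N 0 = {0} := by
      ext J
      rw [mem_idxUpTo, Finset.mem_singleton]
      constructor
      · intro hJ
        exact funext fun i => Finset.sum_eq_zero_iff.1 (Nat.le_zero.1 hJ) i (Finset.mem_univ i)
      · rintro rfl
        simp [order]
    have := H 1 isBase_one
    rw [h0] at this ⊢
    simpa [totalDPow_zero] using this
  | succ k ih =>
    have h1 : ∀ i, ∀ J ∈ idxUpTo N k, (J i + 1 : ℝ) • h (raise i J) = 0 := by
      intro i
      refine ih (fun J => (J i + 1 : ℝ) • h (raise i J)) fun a ha => ?_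
      -- The hypothesis for `x^i * a` minus `x^i` times the hypothesis for `a`.
      have e : ∑ J ∈ idxUpTo N (k + 1),
          (totalDPow J (xCoord i * (a * h J)) - xCoord i * totalDPow J (a * h J)) = 0 := by
        rw [Finset.sum_sub_distrib, ← Finset.mul_sum, H a ha, mul_zero, sub_zero]
        simpa only [mul_assoc] using H _ ((isBase_xCoord i).mul ha)
      rw [sum_idxUpTo_succ i k] at e
      · simpa only [(totalDPow_xCoord_mul i _).2, add_sub_cancel_left, mul_smul_comm,
          map_smul] using e
      · intro J hJ
        rw [(totalDPow_xCoord_mul i J).1 hJ, sub_self]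
    have h2 : ∀ J ∈ idxUpTo N (k + 1), J ≠ 0 → h J = 0 := by
      intro J hJ hJ0
      obtain ⟨i, hi⟩ := Function.ne_iff.1 hJ0
      obtain ⟨K, rfl⟩ := exists_eq_raise hi
      rw [mem_idxUpTo, order_raise] at hJ
      have h3 := h1 i K (mem_idxUpTo.2 (by omega))
      exact (smul_eq_zero.1 h3).resolve_left (by positivity)
    intro J hJ
    by_cases hJ0 : J = 0
    · have e := H 1 isBase_one
      rw [Finset.sum_eq_single 0] at e
      · simpa [totalDPow_zero, hJ0] using e
      · intro K hK hK0
        rw [h2 K hK hK0, mul_zero, map_zero]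
      · intro h0
        exact absurd (mem_idxUpTo.2 (by simp [order])) h0
    · exact h2 J hJ hJ0

/-- A local function all of whose multiples by functions of `x` are total divergences depends only
on `x`. -/
theorem isBase_of_mul_mem_totalDivergences {g : Loc N}
    (H : ∀ a, IsBase a → a * g ∈ totalDivergences N) : IsBase g := by
  obtain ⟨k, hg⟩ := exists_orderLE g
  -- Since `∂/∂u_J` passes through `a`, these are the coefficients of the Euler operator applied to
  -- `a * g`.
  have key := eq_zero_of_sum_totalDPow_mul_eq_zero k (fun J => (-1 : ℝ) ^ order J • pdu J g)
    fun a ha => by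
      obtain ⟨l, hl⟩ := exists_forall_euler_eq_zero (H a ha)
      have hag : OrderLE k (a * g) := fun J hJ => by rw [ha.pdu_mul, hg J hJ, mul_zero]
      have e := hl _ (le_max_right k l)
      rw [hag.euler_eq (le_max_left k l), euler_apply] at e
      simpa only [ha.pdu_mul, mul_smul_comm, map_smul] using e
  intro J
  by_cases hJ : order J ≤ k
  · exact (smul_eq_zero.1 (key J (mem_idxUpTo.2 hJ))).resolve_left (by simp)
  · exact hg J (not_le.1 hJ)

/-! ### Integration by parts. -/

/-- Integration by parts. -/
theorem mul_totalDPow_sub_mem_totalDivergences (I : MIdx N) (q g : Loc N) :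
    q * totalDPow I g - (-1) ^ order I * totalDPow I q * g ∈ totalDivergences N := by
  induction I using MIdx.induction generalizing q with
  | zero => simp [totalDPow_zero, order]
  | step i I ih =>
    have h1 : q * totalDPow (raise i I) g + totalD i q * totalDPow I g ∈ totalDivergences N := by
      have := totalD_mem_totalDivergences i (q * totalDPow I g)
      rw [totalD_mul] at this
      rw [totalDPow_raise, Module.End.mul_apply, add_comm]
      exact this
    have h2 := (totalDivergences N).sub_mem h1 (ih (totalD i q))
    have h3 : totalDPow I (totalD i q) = totalDPow (raise i I) q := by
      rw [totalDPow_raise]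
      exact LinearMap.congr_fun (totalDPow_commute I i).eq q
    rw [h3] at h2
    convert h2 using 1
    rw [order_raise, pow_succ]
    ring

/-! ### Slot derivatives and polarized variables. -/

variable {n : ℕ}

theorem totalD_prod {ι : Type*} [DecidableEq ι] (i : Fin N) (s : Finset ι) (f : ι → Loc N) :
    totalD i (∏ j ∈ s, f j) = ∑ j ∈ s, ∏ k ∈ s, Function.update f j (totalD i (f j)) k := by
  induction s using Finset.induction_on with
  | empty =>
    have h := totalD_mul i (1 : Loc N) 1
    simpa using h
  | insert a s ha ih =>
    rw [Finset.prod_insert ha, totalD_mul, ih, Finset.sum_insert ha, Finset.prod_insert ha,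
      Function.update_self, Finset.mul_sum]
    congr 1
    · congr 1
      exact Finset.prod_congr rfl fun k hk =>
        (Function.update_of_ne (by rintro rfl; exact ha hk) _ _).symm
    · refine Finset.sum_congr rfl fun j hj => ?_
      rw [Finset.prod_insert ha, Function.update_of_ne (by rintro rfl; exact ha hj)]

/-- The operation on `n`-linear maps that applies `T` to the `j`-th argument. -/
noncomputable def slotOp (j : Fin n) (T : Module.End ℝ (Loc N)) : Module.End ℝ (Multi N n) :=
  MultilinearMap.compLinearMapₗ
    (Function.update (fun _ => (LinearMap.id : Loc N →ₗ[ℝ] Loc N)) j T)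

theorem slotOp_apply (j : Fin n) (T : Module.End ℝ (Loc N)) (M : Multi N n) (f : Fin n → Loc N) :
    slotOp j T M f = M (Function.update f j (T (f j))) := by
  change M _ = M _
  congr 1
  funext k
  by_cases hk : k = j
  · subst hk
    simp
  · simp [hk]

theorem slotD_apply (j : Fin n) (i : Fin N) (M : Multi N n) (f : Fin n → Loc N) :
    slotD j i M f = M (Function.update f j (totalD i (f j))) :=
  slotOp_apply j (totalD i) M f

theorem slotD_comm (j k : Fin n) (i l : Fin N) : Commute (slotD j i) (slotD k l) := by
  refine LinearMap.ext fun M => MultilinearMap.ext fun f => ?_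
  simp only [Module.End.mul_apply, slotD_apply]
  by_cases hjk : j = k
  · subst hjk
    simp only [Function.update_self, Function.update_idem]
    rw [← Module.End.mul_apply, (totalD_comm l i).eq, Module.End.mul_apply]
  · rw [Function.update_of_ne hjk, Function.update_of_ne (Ne.symm hjk),
      Function.update_comm hjk]

theorem commute_polD [NeZero n] {X : Module.End ℝ (Multi N n)}
    (hX : ∀ k l, Commute X (slotD k l)) (j : Fin n) (i : Fin N) : Commute X (polD j i) := by
  unfold polD
  split_ifs
  · exact Commute.sum_right _ _ _ fun k _ => hX k i
  · exact hX j i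

theorem polD_comm [NeZero n] (j k : Fin n) (i l : Fin N) : Commute (polD j i) (polD k l) :=
  commute_polD (fun _ _ => (commute_polD (fun _ _ => slotD_comm _ _ _ _) _ _).symm) _ _

theorem commute_polDPow [NeZero n] {X : Module.End ℝ (Multi N n)}
    (hX : ∀ k l, Commute X (polD k l)) (I : Fin n → MIdx N) : Commute X (polDPow I) := by
  refine Commute.list_prod_right _ _ fun Y hY => ?_
  obtain ⟨j, rfl⟩ := (List.mem_ofFn' _ _).1 hY
  refine Commute.list_prod_right _ _ fun Y hY => ?_
  obtain ⟨i, rfl⟩ := (List.mem_ofFn' _ _).1 hY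
  exact (hX j i).pow_right _

theorem polDPow_update_raise [NeZero n] (I : Fin n → MIdx N) (j : Fin n) (i : Fin N) :
    polDPow (Function.update I j (raise i (I j))) = polD j i * polDPow I := by
  rw [polDPow, polDPow, ← prod_ofFn_update_mul _ _ _ j]
  · congr 2
    funext k
    by_cases hk : k = j
    · subst hk
      rw [Function.update_self, Function.update_self]
      exact prod_ofFn_pow_add_single _ (fun _ _ => polD_comm _ _ _ _) _ _
    · rw [Function.update_of_ne hk, Function.update_of_ne hk]
  · intro k
    refine Commute.list_prod_right _ _ fun Y hY => ?_
    obtain ⟨l, rfl⟩ := (List.mem_ofFn' _ _).1 hY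
    exact (polD_comm _ _ _ _).pow_right _

/-- The `n`-linear operator `(d/dy_1)^{I₁} ⋯ (d/dy_n)^{I_n}` followed by multiplication. -/
noncomputable def polProd [NeZero n] (I : Fin n → MIdx N) : Multi N n :=
  polDPow I (MultilinearMap.mkPiAlgebra ℝ (Fin n) (Loc N))

theorem polTerm_apply [NeZero n] (I : Fin n → MIdx N) (α : Fin n → MIdx N →₀ ℕ)
    (f : Fin n → Loc N) : polTerm I α f = polProd I fun j => pduPow (α j) (f j) := rfl

/-- The Leibniz rule; this is what makes the polarized variables useful. -/
theorem polD_zero_mkPiAlgebra [NeZero n] (i : Fin N) :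
    polD 0 i (MultilinearMap.mkPiAlgebra ℝ (Fin n) (Loc N)) =
      (totalD i).compMultilinearMap (MultilinearMap.mkPiAlgebra ℝ (Fin n) (Loc N)) := by
  ext1 f
  rw [polD, if_pos rfl, LinearMap.sum_apply, _root_.sum_apply]
  simp only [slotD_apply, LinearMap.compMultilinearMap_apply, MultilinearMap.mkPiAlgebra_apply]
  exact (totalD_prod i Finset.univ f).symm

theorem polD_zero_polProd [NeZero n] (i : Fin N) (I : Fin n → MIdx N) :
    polD 0 i (polProd I) = (totalD i).compMultilinearMap (polProd I) := by
  have h1 : polD 0 i (polProd I) =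
      polDPow I (polD 0 i (MultilinearMap.mkPiAlgebra ℝ (Fin n) (Loc N))) :=
    LinearMap.congr_fun (commute_polDPow (fun _ _ => polD_comm _ _ _ _) I).eq _
  -- One operation acts on the output and the other on the inputs, so they commute.
  have h2 : Commute (LinearMap.compMultilinearMapₗ ℝ (totalD i) : Module.End ℝ (Multi N n))
      (polDPow I) := commute_polDPow (fun _ _ => commute_polD (fun _ _ => by rfl) _ _) I
  rw [h1, polD_zero_mkPiAlgebra]
  exact (LinearMap.congr_fun h2.eq _).symm

theorem polProd_update_zero [NeZero n] (I : Fin n → MIdx N) (J : MIdx N) :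
    polProd (Function.update I 0 J) =
      (totalDPow J).compMultilinearMap (polProd (Function.update I 0 0)) := by
  induction J using MIdx.induction with
  | zero =>
    rw [totalDPow_zero]
    rfl
  | step i J ih =>
    have h := polDPow_update_raise (Function.update I 0 J) 0 i
    rw [Function.update_self, Function.update_idem] at h
    have h2 : Commute (LinearMap.compMultilinearMapₗ ℝ (totalDPow J) : Module.End ℝ (Multi N n))
      (polD 0 i) := commute_polD (fun _ _ => by rfl) _ _
    have h3 : polProd (Function.update I 0 (raise i J)) =
        polD 0 i (polProd (Function.update I 0 J)) := LinearMap.congr_fun h _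
    rw [h3, ih]
    refine (LinearMap.congr_fun h2.eq _).symm.trans ?_
    rw [totalDPow_raise, ← (totalDPow_commute J i).eq]
    exact congrArg (LinearMap.compMultilinearMapₗ ℝ (totalDPow J)) (polD_zero_polProd i _)

theorem polTerm_eq_totalDPow [NeZero n] (I : Fin n → MIdx N) (α : Fin n → MIdx N →₀ ℕ)
    (f : Fin n → Loc N) :
    polTerm I α f = totalDPow (I 0) (polTerm (Function.update I 0 0) α f) := by
  have h := polProd_update_zero I (I 0)
  rw [Function.update_eq_self] at h
  rw [polTerm_apply, h]
  rfl

/-- Each `f j` has finite order, so `pduPow (c.2 j) (f j)` vanishes once `degf (c.2 j)` exceeds it;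
what remains is controlled by the finiteness condition. -/
theorem CoeffFinite.finite_support {q : TermIdx N n → Loc N} (hq : CoeffFinite q)
    (M : (Fin n → MIdx N) → Multi N n) (f : Fin n → Loc N) :
    (Function.support fun c : TermIdx N n =>
      q c * M c.1 fun j => pduPow (c.2 j) (f j)).Finite := by
  choose k hk using fun j => (f j).2
  refine (hq (∑ j, k j)).subset fun c hc => ⟨Finset.sum_le_sum fun j _ => ?_, fun h => hc ?_⟩
  · by_contra h
    refine hc ?_
    change _ * _ = _
    rw [MultilinearMap.map_coord_zero _ j (pduPow_eq_zero (not_le.1 h) (hk j)), mul_zero]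
  · change _ * _ = _
    rw [h, zero_mul]

theorem apply_sub_charSum_mem_totalDivergences [NeZero n] {A : Multi N n}
    {q : TermIdx N n → Loc N} (hq : IsPolarizedForm A q) (f : Fin n → Loc N) :
    A f - charSum q hq.1 f ∈ totalDivergences N := by
  have h1 : charSum q hq.1 f = ∑ᶠ c, charTerm q c f := rfl
  have h2 : (Function.support fun c => q c * polTerm c.1 c.2 f).Finite :=
    hq.1.finite_support polProd f
  rw [hq.2 f, h1, ← finsum_sub_distrib h2 (finite_charTerm_ne_zero hq.1 f)]
  refine finsum_induction (· ∈ totalDivergences N) (Submodule.zero_mem _)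
    (fun _ _ => Submodule.add_mem _) fun c => ?_
  rw [polTerm_eq_totalDPow]
  exact mul_totalDPow_sub_mem_totalDivergences _ _ _

/-! ### Existence of a polarized form. -/

/-- The operators that are combinations of the `(d/dy_1)^{I₁} ⋯ (d/dy_n)^{I_n}` with local
coefficients. -/
noncomputable def polarizable (N n : ℕ) [NeZero n] : Submodule (Loc N) (Multi N n) :=
  Submodule.span (Loc N) (Set.range polProd)

theorem polD_smul [NeZero n] (j : Fin n) (i : Fin N) (a : Loc N) (M : Multi N n) :
    polD j i (a • M) = a • polD j i M := by
  unfold polD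
  split_ifs
  · rw [LinearMap.sum_apply, LinearMap.sum_apply, Finset.smul_sum]
    rfl
  · rfl

theorem polD_mem_polarizable [NeZero n] (j : Fin n) (i : Fin N) {M : Multi N n}
    (hM : M ∈ polarizable N n) : polD j i M ∈ polarizable N n := by
  induction hM using Submodule.span_induction with
  | mem M h =>
    obtain ⟨I, rfl⟩ := h
    have : polD j i (polProd I) = polProd (Function.update I j (raise i (I j))) :=
      (LinearMap.congr_fun (polDPow_update_raise I j i) _).symm
    rw [this]
    exact Submodule.subset_span ⟨_, rfl⟩
  | zero => rw [map_zero]; exact Submodule.zero_mem _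
  | add M M' _ _ h h' => rw [map_add]; exact Submodule.add_mem _ h h'
  | smul a M _ h => rw [polD_smul]; exact Submodule.smul_mem _ _ h

/-- The change of variables is invertible: `d/dx_1` is `d/dy_1` minus the other `d/dy_j`. -/
theorem slotD_mem_polarizable [NeZero n] (j : Fin n) (i : Fin N) {M : Multi N n}
    (hM : M ∈ polarizable N n) : slotD j i M ∈ polarizable N n := by
  have hne : ∀ j : Fin n, j ≠ 0 → slotD j i M ∈ polarizable N n := fun j hj => by
    have := polD_mem_polarizable j i hM
    rwa [polD, if_neg hj] at this
  by_cases hj : j = 0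
  · subst hj
    have h := polD_mem_polarizable 0 i hM
    rw [polD, if_pos rfl, LinearMap.sum_apply, ← Finset.add_sum_erase _ _ (Finset.mem_univ 0)] at h
    have h' : ∑ k ∈ Finset.univ.erase 0, slotD k i M ∈ polarizable N n :=
      Submodule.sum_mem _ fun k hk => hne k (Finset.ne_of_mem_erase hk)
    have := (polarizable N n).add_mem h ((polarizable N n).smul_mem (-1 : Loc N) h')
    have e : ∀ X Y : Multi N n, X + Y + (-1 : Loc N) • Y = X := fun X Y =>
      MultilinearMap.ext fun f => by
        change X f + Y f + (-1) * Y f = X f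
        ring
    rwa [e] at this
  · exact hne j hj

theorem slotOp_totalDPow_mem_polarizable [NeZero n] (j : Fin n) (J : MIdx N) {M : Multi N n}
    (hM : M ∈ polarizable N n) : slotOp j (totalDPow J) M ∈ polarizable N n := by
  induction J using MIdx.induction generalizing M with
  | zero =>
    have : slotOp j (totalDPow 0) M = M := MultilinearMap.ext fun f => by
      rw [slotOp_apply, totalDPow_zero, Module.End.one_apply, Function.update_eq_self]
    rwa [this]
  | step i J ih =>
    have : slotOp j (totalDPow (raise i J)) M = slotOp j (totalDPow J) (slotD j i M) :=
      MultilinearMap.ext fun f => by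
        simp only [slotOp_apply, slotD_apply, Function.update_self, Function.update_idem,
          totalDPow_raise, Module.End.mul_apply]
    rw [this]
    exact ih (slotD_mem_polarizable j i hM)

/-- The `n`-linear operator `∏_j (d/dx)^{I_j} f_j`. -/
noncomputable def slotProd (I : Fin n → MIdx N) : Multi N n :=
  (MultilinearMap.mkPiAlgebra ℝ (Fin n) (Loc N)).compLinearMap fun j => totalDPow (I j)

theorem slotProd_apply (I : Fin n → MIdx N) (f : Fin n → Loc N) :
    slotProd I f = ∏ j, totalDPow (I j) (f j) := rfl

theorem slotProd_mem_polarizable [NeZero n] (I : Fin n → MIdx N) :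
    slotProd I ∈ polarizable N n := by
  classical
  have key : ∀ s : Finset (Fin n), slotProd (fun j => if j ∈ s then I j else 0) ∈
      polarizable N n := by
    intro s
    induction s using Finset.induction_on with
    | empty =>
      refine Submodule.subset_span ⟨0, MultilinearMap.ext fun f => ?_⟩
      rw [slotProd_apply]
      simp [polProd, polDPow, totalDPow_zero, List.ofFn_const]
    | insert a s ha ih =>
      have h : slotProd (fun j => if j ∈ insert a s then I j else 0) =
          slotOp a (totalDPow (I a)) (slotProd fun j => if j ∈ s then I j else 0) := by
        ext1 f
        rw [slotOp_apply, slotProd_apply, slotProd_apply]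
        refine Finset.prod_congr rfl fun j _ => ?_
        by_cases hj : j = a
        · subst hj
          simp [ha, totalDPow_zero]
        · simp [hj]
      rw [h]
      exact slotOp_totalDPow_mem_polarizable a (I a) ih
  simpa using key Finset.univ

theorem finsum_prod_swap {α β M : Type*} [AddCommMonoid M] (F : α × β → M)
    (hF : (Function.support F).Finite) : ∑ᶠ c, F c = ∑ᶠ b, ∑ᶠ a, F (a, b) := by
  rw [← finsum_comp_equiv (Equiv.prodComm β α), finsum_curry]
  · rfl
  · exact hF.preimage (Equiv.prodComm β α).injective.injOn

/-- For fixed `α` only finitely many `I` occur, so polarizing is a statement about a finite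
combination; the results are reassembled over `α`. -/
theorem exists_isPolarizedForm [NeZero n] {A : Multi N n} (hA : IsLDO A) :
    ∃ q, IsPolarizedForm A q := by
  classical
  obtain ⟨p, hp, hAp⟩ := hA
  have hfin : ∀ α : Fin n → MIdx N →₀ ℕ, {I | p (I, α) ≠ 0}.Finite := fun α =>
    ((hp (∑ j, degf (α j))).image Prod.fst).subset fun I hI => ⟨(I, α), ⟨le_rfl, hI⟩, rfl⟩
  -- Demanding `Q = 0` when no `p (I, α)` survives keeps the set of active `α` from growing, so that
  -- the finiteness condition carries over.
  have hQ : ∀ α : Fin n → MIdx N →₀ ℕ, ∃ Q : (Fin n → MIdx N) →₀ Loc N,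
      ((∀ I, p (I, α) = 0) → Q = 0) ∧ ∀ g : Fin n → Loc N,
        ∑ᶠ I, p (I, α) * slotProd I g = ∑ᶠ I, Q I * polProd I g := by
    intro α
    by_cases h0 : ∀ I, p (I, α) = 0
    · exact ⟨0, fun _ => rfl, fun g => by simp [h0]⟩
    · have hmem : ∑ I ∈ (hfin α).toFinset, p (I, α) • slotProd I ∈ polarizable N n :=
        Submodule.sum_mem _ fun I _ => Submodule.smul_mem _ _ (slotProd_mem_polarizable I)
      obtain ⟨Q, hQ⟩ := Finsupp.mem_span_range_iff_exists_finsupp.1 hmem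
      refine ⟨Q, fun h => absurd h h0, fun g => ?_⟩
      rw [finsum_eq_sum_of_support_subset (s := (hfin α).toFinset),
        finsum_eq_sum_of_support_subset (s := Q.support)]
      · have := congrArg (fun M : Multi N n => M g) hQ
        simp only [Finsupp.sum, _root_.sum_apply, _root_.smul_apply,
          smul_eq_mul] at this
        exact this.symm
      · intro I hI
        rw [Finset.mem_coe, Finsupp.mem_support_iff]
        exact left_ne_zero_of_mul hI
      · intro I hI
        rw [Set.Finite.coe_toFinset]
        exact left_ne_zero_of_mul hI
  choose Q hQ0 hQ using hQ
  have hq : CoeffFinite fun c : TermIdx N n => Q c.2 c.1 := by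
    intro m
    refine (((hp m).image Prod.snd).biUnion fun α _ =>
      ((Q α).support.finite_toSet.image fun I => (I, α))).subset fun c hc => ?_
    have h : ¬∀ I, p (I, c.2) = 0 := fun h => hc.2 (by simp [hQ0 _ h])
    push Not at h
    obtain ⟨I, hI⟩ := h
    exact Set.mem_biUnion (x := c.2) ⟨(I, c.2), ⟨hc.1, hI⟩, rfl⟩
      ⟨c.1, Finset.mem_coe.2 (Finsupp.mem_support_iff.2 hc.2), rfl⟩
  refine ⟨_, hq, fun f => ?_⟩
  rw [hAp f]
  refine (finsum_prod_swap _ (hp.finite_support slotProd f)).trans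
    (Eq.trans ?_ (finsum_prod_swap _ (hq.finite_support polProd f)).symm)
  exact finsum_congr fun α => hQ α fun j => pduPow (α j) (f j)

/-! ### The characteristic as a function of its first argument. -/

/-- With exponent `0` in the first polarized variable, only derivatives in the other slots occur, so
the first argument is a mere factor. The property is preserved by each such slot derivative. -/
theorem polProd_update_zero_mul [NeZero n] (I : Fin n → MIdx N) (g : Loc N) (f : Fin n → Loc N) :
    polProd (Function.update I 0 0) (Function.update f 0 g) =
      g * polProd (Function.update I 0 0) (Function.update f 0 1) := by
  let C : Multi N n → Prop := fun M => ∀ f : Fin n → Loc N,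
    M (Function.update f 0 g) = g * M (Function.update f 0 1)
  let P : Module.End ℝ (Multi N n) → Prop := fun X => ∀ M, C M → C (X M)
  have hmul : ∀ X Y, P X → P Y → P (X * Y) := fun X Y hX hY M hM => hX _ (hY M hM)
  have hone : P 1 := fun M hM => hM
  have hpow : ∀ X, P X → ∀ m : ℕ, P (X ^ m) := fun X hX m => by
    induction m with
    | zero => rwa [pow_zero]
    | succ m ih => rw [pow_succ]; exact hmul _ _ ih hX
  have hslot : ∀ j : Fin n, j ≠ 0 → ∀ i : Fin N, P (slotD j i) := fun j hj i M hM f => by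
    rw [slotD_apply, slotD_apply, Function.update_of_ne hj, Function.update_of_ne hj,
      Function.update_comm hj.symm, hM, Function.update_comm hj]
  have hall : P (polDPow (Function.update I 0 0)) := by
    refine List.prod_induction P hmul hone fun Y hY => ?_
    obtain ⟨j, rfl⟩ := (List.mem_ofFn' _ _).1 hY
    refine List.prod_induction P hmul hone fun Y hY => ?_
    obtain ⟨i, rfl⟩ := (List.mem_ofFn' _ _).1 hY
    beta_reduce
    by_cases hj : j = 0
    · subst hj
      rw [Function.update_self, Pi.zero_apply, pow_zero]
      exact hone
    · rw [polD, if_neg hj]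
      exact hpow _ (hslot j hj i) _
  refine hall _ (fun f => ?_) f
  rw [MultilinearMap.mkPiAlgebra_apply, MultilinearMap.mkPiAlgebra_apply,
    Finset.prod_update_of_mem (Finset.mem_univ _), Finset.prod_update_of_mem (Finset.mem_univ _),
    one_mul]

theorem exists_charTerm_update [NeZero n] (q : TermIdx N n → Loc N) (c : TermIdx N n)
    (f : Fin n → Loc N) : ∃ s : Loc N, ∀ g, charTerm q c (Function.update f 0 g) =
      s * pduPow (c.2 0) g := by
  refine ⟨(-1) ^ order (c.1 0) * totalDPow (c.1 0) (q c) *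
    polProd (Function.update c.1 0 0)
      (Function.update (fun j => pduPow (c.2 j) (f j)) 0 1), fun g => ?_⟩
  have h : (fun j => pduPow (c.2 j) (Function.update f 0 g j)) =
      Function.update (fun j => pduPow (c.2 j) (f j)) 0 (pduPow (c.2 0) g) := by
    funext j
    by_cases hj : j = 0
    · subst hj
      simp
    · simp [hj]
  rw [charTerm, _root_.smul_apply, polTerm_apply, h, polProd_update_zero_mul, smul_eq_mul]
  ring

theorem pduPow_induction (P : Module.End ℝ (Loc N) → Prop) (mul : ∀ X Y, P X → P Y → P (X * Y))
    (one : P 1) (hP : ∀ J, P (pdu J)) (α : MIdx N →₀ ℕ) : P (pduPow α) := by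
  refine List.prod_induction P mul one fun Y hY => ?_
  obtain ⟨J, -, rfl⟩ := List.mem_map.1 hY
  generalize α J = m
  induction m with
  | zero => rwa [pow_zero]
  | succ m ih => rw [pow_succ]; exact mul _ _ ih (hP J)

theorem IsBase.pduPow_mul {a : Loc N} (ha : IsBase a) (α : MIdx N →₀ ℕ) (g : Loc N) :
    pduPow α (a * g) = a * pduPow α g := by
  refine pduPow_induction (fun X => ∀ g, X (a * g) = a * X g) (fun X Y hX hY g => ?_)
    (fun _ => rfl) (fun J g => ha.pdu_mul J g) α g
  rw [Module.End.mul_apply, Module.End.mul_apply, hY, hX]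

theorem pduPow_apply_eq_zero {s : Set ℝ} (hs : IsOpen s) {J : MIdx N} {g : Loc N}
    (hg : ∀ z : Jet N, z.2 J ∈ s → g.1 z = 0) (α : MIdx N →₀ ℕ) {z : Jet N} (hz : z.2 J ∈ s) :
    (pduPow α g).1 z = 0 :=
  pduPow_induction
    (fun X => ∀ g : Loc N, (∀ z : Jet N, z.2 J ∈ s → g.1 z = 0) →
      ∀ z : Jet N, z.2 J ∈ s → (X g).1 z = 0)
    (fun _ _ hX hY g hg => hX _ (hY g hg)) (fun _ hg => hg)
    (fun _ _ hg _ hz => dirDeriv_apply_eq_zero hs hg hz) α g hg z hz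

theorem charSum_update_base_mul [NeZero n] {q : TermIdx N n → Loc N} (hq : CoeffFinite q)
    {a : Loc N} (ha : IsBase a) (f : Fin n → Loc N) (g : Loc N) :
    charSum q hq (Function.update f 0 (a * g)) = a * charSum q hq (Function.update f 0 g) := by
  change ∑ᶠ c, _ = a * ∑ᶠ c, _
  rw [mul_finsum' _ _ (finite_charTerm_ne_zero hq _)]
  refine finsum_congr fun c => ?_
  obtain ⟨s, hs⟩ := exists_charTerm_update q c f
  rw [hs, hs, ha.pduPow_mul]
  ring

theorem charSum_update_apply_eq_zero [NeZero n] {q : TermIdx N n → Loc N} (hq : CoeffFinite q)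
    {s : Set ℝ} (hs : IsOpen s) {J : MIdx N} {g : Loc N}
    (hg : ∀ z : Jet N, z.2 J ∈ s → g.1 z = 0) (f : Fin n → Loc N) {z : Jet N} (hz : z.2 J ∈ s) :
    (charSum q hq (Function.update f 0 g)).1 z = 0 := by
  -- Evaluation at `z`, as an additive map, passes inside the finite sum.
  let ev : Loc N →+ ℝ :=
    ((Pi.evalRingHom (fun _ : Jet N => ℝ) z).comp (Loc N).val.toRingHom).toAddMonoidHom
  change ev (∑ᶠ c, _) = 0
  rw [ev.map_finsum (finite_charTerm_ne_zero hq _)]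
  refine finsum_eq_zero_of_forall_eq_zero fun c => ?_
  obtain ⟨r, hr⟩ := exists_charTerm_update q c f
  rw [hr]
  change r.1 z * (pduPow (c.2 0) g).1 z = 0
  rw [pduPow_apply_eq_zero hs hg _ hz, mul_zero]

/-- The derivative along the whole line in direction `u_J` vanishes, not only at one point. -/
theorem IsBase.apply_add_smul {g : Loc N} (hg : IsBase g) (J : MIdx N) (z : Jet N) (t : ℝ) :
    g.1 (z + t • (0, Pi.single J 1)) = g.1 z := by
  set v : Jet N := (0, Pi.single J 1)
  obtain ⟨k, G, hG, hgG⟩ := g.2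
  have hd : Differentiable ℝ fun s : ℝ => g.1 (z + s • v) := by
    have hGd := hG.differentiable (by simp)
    simp only [hgG, map_add, map_smul]
    fun_prop
  have h0 : ∀ s, deriv (fun s : ℝ => g.1 (z + s • v)) s = 0 := fun s => by
    have h1 : lineDeriv ℝ g.1 (z + s • v) v = 0 := congrArg (fun h : Loc N => h.1 (z + s • v)) (hg J)
    have h2 := deriv_comp_const_add (fun s : ℝ => g.1 (z + s • v)) s 0
    rw [add_zero] at h2
    rw [← h2]
    simpa only [lineDeriv, add_smul, add_assoc] using h1
  simpa using is_const_of_deriv_eq_zero hd h0 t 0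

/-! ### Vanishing of a characteristic whose values are divergences. -/

/-- A smooth function of `u_J` that is `1` for `u_J ≤ c + 1` and `0` for `u_J ≥ c + 2`. -/
noncomputable def cutoff (J : MIdx N) (c : ℝ) : Loc N :=
  ⟨fun z => Real.smoothTransition (c + 2 - z.2 J), order J,
    fun w => Real.smoothTransition (c + 2 - w.2 ⟨J, mem_idxUpTo.2 le_rfl⟩),
    Real.smoothTransition.contDiff.comp (contDiff_const.sub
      ((contDiff_apply ℝ ℝ (⟨J, mem_idxUpTo.2 le_rfl⟩ : idxUpTo N (order J))).comp contDiff_snd)),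
    fun _ => rfl⟩

theorem charSum_eq_zero [NeZero n] {q : TermIdx N n → Loc N} (hq : CoeffFinite q)
    (H : ∀ f, charSum q hq f ∈ totalDivergences N) : charSum q hq = 0 := by
  have hbase : ∀ f, IsBase (charSum q hq f) := fun f =>
    isBase_of_mul_mem_totalDivergences fun a ha => by
      have h := charSum_update_base_mul hq ha f (f 0)
      rw [Function.update_eq_self] at h
      exact h ▸ H _
  refine MultilinearMap.ext fun f => Subtype.ext (funext fun z => ?_)
  -- Centred at `z`: `b` is `1` on a slab containing `z` and `0` on a slab containing its translate
  -- by `3` in the direction `u_0`, as `3 > 2`. The piece with `1 - b` is tested at `z`, the piece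
  -- with `b` at the translate.
  set b := cutoff (0 : MIdx N) (z.2 0)
  have h1 : charSum q hq f = charSum q hq (Function.update f 0 (b * f 0)) +
      charSum q hq (Function.update f 0 ((1 - b) * f 0)) := by
    rw [← MultilinearMap.map_update_add, ← add_mul, add_sub_cancel, one_mul,
      Function.update_eq_self]
  have h2 : (charSum q hq (Function.update f 0 ((1 - b) * f 0))).1 z = 0 := by
    refine charSum_update_apply_eq_zero hq (isOpen_Iio (a := z.2 0 + 1)) (J := 0)
      (fun y hy => ?_) f (Set.mem_Iio.2 (lt_add_one _))
    have : b.1 y = 1 := Real.smoothTransition.one_of_one_le (by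
      rw [Set.mem_Iio] at hy; linarith)
    change (1 - b.1 y) * (f 0).1 y = 0
    rw [this, sub_self, zero_mul]
  have h3 : (charSum q hq (Function.update f 0 (b * f 0))).1
      (z + (3 : ℝ) • (0, Pi.single 0 1)) = 0 := by
    refine charSum_update_apply_eq_zero hq (isOpen_Ioi (a := z.2 0 + 2)) (J := 0)
      (fun y hy => ?_) f (Set.mem_Ioi.2 ?_)
    · have : b.1 y = 0 := Real.smoothTransition.zero_of_nonpos (by
        rw [Set.mem_Ioi] at hy; linarith)
      change b.1 y * (f 0).1 y = 0
      rw [this, zero_mul]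
    · have : (z + (3 : ℝ) • ((0, Pi.single 0 1) : Jet N)).2 0 = z.2 0 + 3 := by simp
      rw [this]
      linarith
  rw [(hbase _).apply_add_smul] at h3
  change (charSum q hq f).1 z = 0
  rw [h1]
  change (charSum q hq _).1 z + (charSum q hq _).1 z = 0
  rw [h2, h3, add_zero]

/-! ### Exact top-degree forms as total divergences. -/

theorem exists_dH_eq_iff {η : HForm N} (hη : ∀ S, S.card ≠ N → η S = 0) :
    (∃ β ∈ horizontal N (N - 1), dH β = η) ↔ η Finset.univ ∈ totalDivergences N := by
  have hcard : ∀ (i : Fin N), (Finset.univ.erase i).card = N - 1 := fun i => by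
    rw [Finset.card_erase_of_mem (Finset.mem_univ i), Finset.card_univ, Fintype.card_fin]
  have hsign : ∀ (m : ℕ) (i : Fin N) (g : Loc N),
      (-1 : Loc N) ^ m * totalD i g = totalD i ((-1) ^ m * g) := fun m i g => by
    rcases neg_one_pow_eq_or (Loc N) m with h | h <;> simp [h]
  constructor
  · rintro ⟨β, -, rfl⟩
    refine Submodule.sum_mem _ fun i _ => ?_
    rw [hsign]
    exact totalD_mem_totalDivergences i _
  · intro h
    obtain ⟨g, hg⟩ := mem_totalDivergences.1 h
    -- The sign in `dH` is put into `β` as well, so that the two cancel.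
    let sgn : Fin N → Loc N := fun i => (-1) ^ (Finset.univ.filter (· < i)).card
    let β : HForm N := fun S => ∑ i, if S = Finset.univ.erase i then sgn i * g i else 0
    have hβ : β ∈ horizontal N (N - 1) := fun S hS =>
      Finset.sum_eq_zero fun i _ => if_neg fun h => hS ((congrArg Finset.card h).trans (hcard i))
    refine ⟨β, hβ, funext fun S => ?_⟩
    by_cases hS : S = Finset.univ
    · subst hS
      rw [← hg]
      refine Finset.sum_congr rfl fun i _ => ?_
      have h1 : β (Finset.univ.erase i) = sgn i * g i := by
        refine (Finset.sum_eq_single i (fun j _ hj => if_neg fun h => hj ?_) (by simp)).trans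
          (if_pos rfl)
        have := Finset.notMem_erase i Finset.univ
        rw [h] at this
        by_contra hij
        exact this (Finset.mem_erase.2 ⟨Ne.symm hij, Finset.mem_univ _⟩)
      rw [h1, hsign, ← mul_assoc, ← mul_pow, show (-1 : Loc N) * -1 = 1 by ring, one_pow,
        one_mul]
    · have hS' : S.card < N := by
        simpa using Finset.card_lt_card (Finset.ssubset_univ_iff.2 hS)
      rw [hη S hS'.ne]
      refine Finset.sum_eq_zero fun i hi => ?_
      rw [hβ, map_zero, mul_zero]
      have := Finset.card_pos.2 ⟨i, hi⟩
      rw [Finset.card_erase_of_mem hi]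
      omega

theorem exists_dH_eq_eval_iff (A : OpForm N n N) (f : Fin n → Loc N) :
    (∃ β ∈ horizontal N (N - 1), dH β = A.eval f) ↔ A.top f ∈ totalDivergences N :=
  exists_dH_eq_iff fun S hS => by rw [OpForm.eval, A.coeff_eq_zero S hS]; rfl

end HorizontalLDO

theorem proposition6p4 (N n : ℕ) (hN : 1 ≤ N) [NeZero n] (A : HorizontalLDO.OpForm N n N) :
    (∀ f : Fin n → HorizontalLDO.Loc N,
        ∃ β ∈ HorizontalLDO.horizontal N (N - 1), HorizontalLDO.dH β = A.eval f) ↔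
      HorizontalLDO.characteristic A.top = 0 := by
  have hex := HorizontalLDO.exists_isPolarizedForm (A.isLDO Finset.univ)
  change ∃ q, HorizontalLDO.IsPolarizedForm A.top q at hex
  -- Everything below holds for any polarized form, so uniqueness plays no role for the chosen one.
  have hsub := HorizontalLDO.apply_sub_charSum_mem_totalDivergences hex.choose_spec
  rw [HorizontalLDO.characteristic, dif_pos hex]
  simp only [HorizontalLDO.exists_dH_eq_eval_iff]
  constructor
  · refine fun H => HorizontalLDO.charSum_eq_zero _ fun f => ?_
    exact (Submodule.sub_mem_iff_right _ (H f)).1 (hsub f)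
  · intro h0 f
    simpa [h0] using hsub f
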